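/- **Language.** Types are generated from $\mathtt{Nat}$ and $\mathtt{Nat}^*$ (finite lists of numbers) by $\rho\to\tau$. Terms are the simply typed $\lambda$-terms over the constructors $\mathtt 0:\mathtt{Nat}$, $\mathtt s:\mathtt{Nat}\to\mathtt{Nat}$, $\varepsilon:\mathtt{Nat}^*$, ${::}:\mathtt{Nat}^*\to\mathtt{Nat}\to\mathtt{Nat}^*$ (which appends an entry at the end) and the function symbols $\mathtt{fold}_\rho:\rho\to(\mathtt{Nat}\to\rho\to\rho)\to\mathtt{Nat}^*\to\rho$ for every type $\rho$; $+,\times,<\;:\mathtt{Nat}\to\mathtt{Nat}\to\mathtt{Nat}$; $\mathtt{len}:\mathtt{Nat}^*\to\mathtt{Nat}$; $\mathtt{ext}:\mathtt{Nat}^*\to\mathtt{Nat}\to\mathtt{Nat}$; $\mathtt{bar}:\rho_1\to\rho_2\to\rho_3\to\mathtt{Nat}^*\to\mathtt{Nat}$; $\mathtt{bar}_1:\rho_1\to\rho_2\to\rho_3\to\mathtt{Nat}^*\to\mathtt{Nat}\to\mathtt{Nat}$, where $\rho_1=(\mathtt{Nat}\to\mathtt{Nat})\to\mathtt{Nat}$,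 $\rho_2=\mathtt{Nat}^*\to\mathtt{Nat}$, $\rho_3=\mathtt{Nat}^*\to(\mathtt{Nat}\to\mathtt{Nat})\to\mathtt{Nat}$. The arity $\mathrm{ar}(f)$ of a function symbol is the number of argument types displayed (so $3$ for every $\mathtt{fold}_\rho$). Write $\underline n$, $\underline a$ for the numerals of $n\in\mathbb N$, $a\in\mathbb N^*$, $|a|$ for the length of $a$, $a*n$ for $a$ with $n$ appended, and $\hat a_i$ for the entry of $a$ at position $i$ (counted from $0$) if $i<|a|$, and $0$ otherwise. The defining rules are $$\mathtt{fold}\,x\,y\,\varepsilon\leadsto x,\qquad \mathtt{fold}\,x\,y\,(zs::z)\leadsto y\,z\,(\mathtt{fold}\,x\,y\,zs),$$ $$\underline m+\underline n\leadsto\underline{m+n},\quad \underline m\times\underline n\leadsto\underline{mn},\quad \underline m<\underline n\leadsto \underline 0\text{ if }m<n\text{ and }\underline 1\text{ otherwise},\quad \mathtt{len}\,\underline a\leadsto\underline{|a|},\quad \mathtt{ext}\,\underline a\,\underline n\leadsto\underline{\hat a_n},$$ $$\mathtt{bar}\,f\,g\,h\,xs\leadsto\mathtt{bar}_1\,f\,g\,h\,xs\,(f(\mathtt{ext}\,xs)<\mathtt{len}\,xs),$$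 $$\mathtt{bar}_1\,f\,g\,h\,xs\,\mathtt 0\leadsto g\,xs,\qquad \mathtt{bar}_1\,f\,g\,h\,xs\,(\mathtt s z)\leadsto h\,xs\,(\lambda x.\,\mathtt{bar}\,f\,g\,h\,(xs::x)).$$ **Cost semantics.** Values are the closed terms $\lambda x.r$, constructors applied to values, and function symbols $f$ applied to fewer than $\mathrm{ar}(f)$ values. The relation $e\downarrow^c v$ ($e$ a closed term, $c\in\mathbb N$, $v$ a value) is generated by: $v\downarrow^0v$ for values $v$; if $r[u/x]\downarrow^cv$ with $u$ a value, then $(\lambda x.r)u\downarrow^{c+1}v$; if $fp_1\cdots p_k\leadsto r$ is a rule, $\sigma$ maps its variables to values and $r\sigma\downarrow^cv$, then $f(p_1\sigma)\cdots(p_k\sigma)\downarrow^{c+1}v$; if $e,e'$ are not both values and $e\downarrow^{c_0}u$, $e'\downarrow^{c_1}v$, $uv\downarrow^{c_2}w$, then $ee'\downarrow^{c_0+c_1+c_2}w$. **Denotations.** In the hierarchy of total continuous functionals over $\mathbb N$ and $\mathbb N^*$ (with products and function spaces $\Rightarrow$ taken in limit spaces, the base types being discrete) put $[\![[\mathtt{Nat}]]\!]=\mathbb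 N$, $[\![[\mathtt{Nat}^*]]\!]=\mathbb N^*$, $[\![[\rho\to\tau]]\!]=[\![[\rho]]\!]\Rightarrow\mathbb N\times[\![[\tau]]\!]$. Write $c\oplus(d,x)=(c+d,x)$ and $f\circ a=\bigl(\pi_0f+\pi_0a+\pi_0((\pi_1f)(\pi_1a)),\ \pi_1((\pi_1f)(\pi_1a))\bigr)$. A term $t:\rho$ in a context $\Gamma$ and an environment $\xi$, assigning to each variable $x:\sigma$ of $\Gamma$ an element of $[\![[\sigma]]\!]$, have the denotation $[\![[t]]\!]\xi\in\mathbb N\times[\![[\rho]]\!]$, given (through a translation into a monadic metalanguage) by $$[\![[x]]\!]\xi=(0,\xi(x)),\qquad [\![[\lambda x.t]]\!]\xi=\bigl(0,\ a\mapsto 1\oplus[\![[t]]\!]\xi\{x\mapsto a\}\bigr),\qquad [\![[ts]]\!]\xi=[\![[t]]\!]\xi\circ[\![[s]]\!]\xi.$$ A constructor or function symbol denotes its interpretation, curried, with cost $0$ for every argument received before the last. The constructors have their usual interpretation, with cost $0$ also at the last argument, and the function symbols, supplied with all their arguments, are interpreted by the pairs $\bar+(m,n)=(1,m+n)$, $\bar\times(m,n)=(1,mn)$,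 $\bar<(m,n)=(1,0)$ if $m<n$ and $(1,1)$ otherwise, $\overline{\mathtt{len}}(a)=(1,|a|)$, $\overline{\mathtt{ext}}(a,i)=(1,\hat a_i)$, $$\overline{\mathtt{fold}}(b,h,[])=1\oplus(0,b),\qquad \overline{\mathtt{fold}}(b,h,a*n)=1\oplus\bigl(h(n)\circ\overline{\mathtt{fold}}(b,h,a)\bigr),$$ $$\overline{\mathtt{bar}}(\omega,g,h,a)=\bigl(4+\pi_0\,\omega(\alpha)\bigr)\oplus\begin{cases}g(a)&\text{if }\pi_1\,\omega(\alpha)<|a|,\\ h(a)\circ\bigl(0,\ n\mapsto1\oplus\overline{\mathtt{bar}}(\omega,g,h,a*n)\bigr)&\text{otherwise,}\end{cases}\qquad \alpha(i)=(1,\hat a_i),$$ $$\overline{\mathtt{bar}_1}(\omega,g,h,a,0)=1\oplus g(a),\qquad \overline{\mathtt{bar}_1}(\omega,g,h,a,m+1)=1\oplus\Bigl(h(a)\circ\bigl(0,\ n\mapsto1\oplus\overline{\mathtt{bar}}(\omega,g,h,a*n)\bigr)\Bigr).$$ **Statement.** For every type $\rho$ and every closed term $e:\rho$ of this language there is a value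 $v:\rho$ such that $$e\downarrow^{c}v\qquad\text{with}\qquad c=\pi_0[\![[e]]\!].$$ -/

import Mathlib

namespace BarCost

open Filter

/-! ## The target language: list-based System T with bar recursion -/

/-- Types: the two datatypes of numbers and of finite lists of numbers, and function types. -/
inductive Ty : Type where
  | nat : Ty
  | list : Ty
  | arr : Ty → Ty → Ty

/-- `arrows [ρ₁, …, ρₖ] ρ` is `ρ₁ → ⋯ → ρₖ → ρ`. -/
@[reducible]
def arrows : List Ty → Ty → Ty
  | [], ρ => ρ
  | σ :: σs, ρ => Ty.arr σ (arrows σs ρ)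

/-- Constructors, indexed by their argument types and their result type. -/
inductive Con : List Ty → Ty → Type where
  | zero : Con [] .nat
  | succ : Con [.nat] .nat
  | nil : Con [] .list
  | snoc : Con [.list, .nat] .list

/-- The type of the first argument of bar recursion. -/
abbrev tyOmega : Ty := .arr (.arr .nat .nat) .nat
/-- The type of the second argument of bar recursion. -/
abbrev tyG : Ty := .arr .list .nat
/-- The type of the third argument of bar recursion. -/
abbrev tyH : Ty := .arr .list (.arr (.arr .nat .nat) .nat)

/-- Function symbols. The first index lists the argument types, so its length is the arity. -/
inductive Fn : List Ty → Ty → Type where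
  | fold (ρ : Ty) : Fn [ρ, .arr .nat (.arr ρ ρ), .list] ρ
  | plus : Fn [.nat, .nat] .nat
  | times : Fn [.nat, .nat] .nat
  | less : Fn [.nat, .nat] .nat
  | len : Fn [.list] .nat
  | ext : Fn [.list, .nat] .nat
  | bar : Fn [tyOmega, tyG, tyH, .list] .nat
  | bar₁ : Fn [tyOmega, tyG, tyH, .list, .nat] .nat

/-- Typed de Bruijn variables (used for both the target language and the metalanguage). -/
inductive Var {T : Type} : List T → T → Type where
  | zero {Γ : List T} {ρ : T} : Var (ρ :: Γ) ρ
  | succ {Γ : List T} {ρ τ : T} : Var Γ ρ → Var (τ :: Γ) ρ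

/-- Terms `Γ ⊢ t : ρ`. -/
inductive Term : List Ty → Ty → Type where
  | var {Γ : List Ty} {ρ : Ty} : Var Γ ρ → Term Γ ρ
  | con {Γ : List Ty} {δs : List Ty} {δ : Ty} : Con δs δ → Term Γ (arrows δs δ)
  | fn {Γ : List Ty} {ρs : List Ty} {ρ : Ty} : Fn ρs ρ → Term Γ (arrows ρs ρ)
  | lam {Γ : List Ty} {ρ τ : Ty} : Term (ρ :: Γ) τ → Term Γ (.arr ρ τ)
  | app {Γ : List Ty} {ρ τ : Ty} : Term Γ (.arr ρ τ) → Term Γ ρ → Term Γ τ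

namespace Term

/-- Extend a renaming under a binder. -/
def liftRen {Γ Δ : List Ty} {σ : Ty} (r : ∀ {τ : Ty}, Var Γ τ → Var Δ τ) :
    ∀ {τ : Ty}, Var (σ :: Γ) τ → Var (σ :: Δ) τ
  | _, .zero => .zero
  | _, .succ x => .succ (r x)

/-- Renaming of variables. -/
def rename : ∀ {Γ Δ : List Ty} {ρ : Ty}, (∀ {τ : Ty}, Var Γ τ → Var Δ τ) → Term Γ ρ → Term Δ ρ
  | _, _, _, r, .var x => .var (r x)
  | _, _, _, _, .con c => .con c
  | _, _, _, _, .fn f => .fn f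
  | _, _, _, r, .lam t => .lam (rename (liftRen r) t)
  | _, _, _, r, .app t s => .app (rename r t) (rename r s)

/-- Extend a substitution under a binder. -/
def liftSub {Γ Δ : List Ty} {σ : Ty} (θ : ∀ {τ : Ty}, Var Γ τ → Term Δ τ) :
    ∀ {τ : Ty}, Var (σ :: Γ) τ → Term (σ :: Δ) τ
  | _, .zero => .var .zero
  | _, .succ x => rename .succ (θ x)

/-- Simultaneous (capture-avoiding) substitution. -/
def subst : ∀ {Γ Δ : List Ty} {ρ : Ty}, (∀ {τ : Ty}, Var Γ τ → Term Δ τ) → Term Γ ρ → Term Δ ρ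
  | _, _, _, θ, .var x => θ x
  | _, _, _, _, .con c => .con c
  | _, _, _, _, .fn f => .fn f
  | _, _, _, θ, .lam t => .lam (subst (liftSub θ) t)
  | _, _, _, θ, .app t s => .app (subst θ t) (subst θ s)

/-- The substitution of a term for the most recently bound variable. -/
def single {Γ : List Ty} {σ : Ty} (u : Term Γ σ) : ∀ {τ : Ty}, Var (σ :: Γ) τ → Term Γ τ
  | _, .zero => u
  | _, .succ x => .var x

/-- `r[u/x]` for the most recently bound variable `x`. -/
def inst {Γ : List Ty} {σ ρ : Ty} (r : Term (σ :: Γ) ρ) (u : Term Γ σ) : Term Γ ρ :=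
  subst (single u) r

/-- A constructor applied to some arguments. -/
def isConApp : ∀ {Γ : List Ty} {ρ : Ty}, Term Γ ρ → Prop
  | _, _, .con _ => True
  | _, _, .app t _ => isConApp t
  | _, _, _ => False

/-- For `t = f t₁ ⋯ tⱼ` with `f` a function symbol, the number `ar(f) - j` of arguments that `f`
still needs (and `0` if `t` does not have a function symbol as its head, or if `j ≥ ar(f)`). -/
def missing : ∀ {Γ : List Ty} {ρ : Ty}, Term Γ ρ → ℕ
  | _, _, .fn (ρs := ρs) _ => ρs.length
  | _, _, .app t _ => missing t - 1
  | _, _, _ => 0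

/-- The term `0`. -/
abbrev zero {Γ : List Ty} : Term Γ .nat := .con .zero
/-- The term `s t`. -/
abbrev succ {Γ : List Ty} (t : Term Γ .nat) : Term Γ .nat := .app (.con .succ) t
/-- The empty list. -/
abbrev nil {Γ : List Ty} : Term Γ .list := .con .nil
/-- The term `t :: s`, where the new entry `s` is added at the end of the list `t`. -/
abbrev snoc {Γ : List Ty} (t : Term Γ .list) (s : Term Γ .nat) : Term Γ .list :=
  .app (.app (.con .snoc) t) s

/-- The numeral of a natural number. -/
def num {Γ : List Ty} : ℕ → Term Γ .nat
  | 0 => zero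
  | n + 1 => succ (num n)

/-- The list numeral `(⋯(ε :: a₁) :: ⋯) :: aₖ` of a finite list of natural numbers. -/
def listNum {Γ : List Ty} (a : List ℕ) : Term Γ .list :=
  a.foldl (fun t n => snoc t (num n)) nil

/-- `fold x y z` -/
abbrev fold {Γ : List Ty} {ρ : Ty} (x : Term Γ ρ) (y : Term Γ (.arr .nat (.arr ρ ρ)))
    (z : Term Γ .list) : Term Γ ρ := .app (.app (.app (.fn (.fold ρ)) x) y) z
/-- `s + t` -/
abbrev plus {Γ : List Ty} (s t : Term Γ .nat) : Term Γ .nat := .app (.app (.fn .plus) s) t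
/-- `s × t` -/
abbrev times {Γ : List Ty} (s t : Term Γ .nat) : Term Γ .nat := .app (.app (.fn .times) s) t
/-- `s < t` -/
abbrev less {Γ : List Ty} (s t : Term Γ .nat) : Term Γ .nat := .app (.app (.fn .less) s) t
/-- `len t` -/
abbrev len {Γ : List Ty} (t : Term Γ .list) : Term Γ .nat := .app (.fn .len) t
/-- `ext t`, of type `Nat → Nat` -/
abbrev ext {Γ : List Ty} (t : Term Γ .list) : Term Γ (.arr .nat .nat) := .app (.fn .ext) t
/-- `bar f g h xs` -/
abbrev bar {Γ : List Ty} (f : Term Γ tyOmega) (g : Term Γ tyG) (h : Term Γ tyH)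
    (xs : Term Γ .list) : Term Γ .nat := .app (.app (.app (.app (.fn .bar) f) g) h) xs
/-- `bar₁ f g h xs z` -/
abbrev bar₁ {Γ : List Ty} (f : Term Γ tyOmega) (g : Term Γ tyG) (h : Term Γ tyH)
    (xs : Term Γ .list) (z : Term Γ .nat) : Term Γ .nat :=
  .app (.app (.app (.app (.app (.fn .bar₁) f) g) h) xs) z

end Term

/-- Variables by their de Bruijn index. -/
abbrev x₀ {Γ : List Ty} {ρ : Ty} : Term (ρ :: Γ) ρ := .var .zero
abbrev x₁ {Γ : List Ty} {ρ σ : Ty} : Term (σ :: ρ :: Γ) ρ := .var (.succ .zero)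
abbrev x₂ {Γ : List Ty} {ρ σ τ : Ty} : Term (τ :: σ :: ρ :: Γ) ρ := .var (.succ (.succ .zero))
abbrev x₃ {Γ : List Ty} {ρ σ τ υ : Ty} : Term (υ :: τ :: σ :: ρ :: Γ) ρ :=
  .var (.succ (.succ (.succ .zero)))
abbrev x₄ {Γ : List Ty} {ρ σ τ υ ν : Ty} : Term (ν :: υ :: τ :: σ :: ρ :: Γ) ρ :=
  .var (.succ (.succ (.succ (.succ .zero))))

/-- The entry of the list `a` at position `i` (counted from `0`), continued by zeros. -/
def hat (a : List ℕ) (i : ℕ) : ℕ := a.getD i 0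

/-- The defining rules `f p₁ ⋯ pₖ ⇝ r` of the function symbols, over a context that holds the
variables of the patterns. -/
inductive Rule : ∀ {Γ : List Ty} {ρ : Ty}, Term Γ ρ → Term Γ ρ → Prop where
  /-- `fold x y ε ⇝ x` -/
  | fold_nil (ρ : Ty) :
      Rule (Γ := [.arr .nat (.arr ρ ρ), ρ]) (Term.fold x₁ x₀ Term.nil) x₁
  /-- `fold x y (zs :: z) ⇝ y z (fold x y zs)`, in the context `z, zs, y, x` -/
  | fold_snoc (ρ : Ty) :
      Rule (Γ := [.nat, .list, .arr .nat (.arr ρ ρ), ρ])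
        (Term.fold x₃ x₂ (Term.snoc x₁ x₀))
        (.app (.app x₂ x₀) (Term.fold x₃ x₂ x₁))
  | plus (m n : ℕ) : Rule (Γ := []) (Term.plus (.num m) (.num n)) (.num (m + n))
  | times (m n : ℕ) : Rule (Γ := []) (Term.times (.num m) (.num n)) (.num (m * n))
  | less (m n : ℕ) :
      Rule (Γ := []) (Term.less (.num m) (.num n)) (.num (if m < n then 0 else 1))
  | len (a : List ℕ) : Rule (Γ := []) (Term.len (.listNum a)) (.num a.length)
  | ext (a : List ℕ) (n : ℕ) :
      Rule (Γ := []) (.app (Term.ext (.listNum a)) (.num n)) (.num (hat a n))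
  /-- `bar f g h xs ⇝ bar₁ f g h xs (f (ext xs) < len xs)`, in the context `xs, h, g, f` -/
  | bar : Rule (Γ := [.list, tyH, tyG, tyOmega])
      (Term.bar x₃ x₂ x₁ x₀)
      (Term.bar₁ x₃ x₂ x₁ x₀ (Term.less (.app x₃ (Term.ext x₀)) (Term.len x₀)))
  /-- `bar₁ f g h xs 0 ⇝ g xs`, in the context `xs, h, g, f` -/
  | bar₁_zero : Rule (Γ := [.list, tyH, tyG, tyOmega])
      (Term.bar₁ x₃ x₂ x₁ x₀ Term.zero)
      (.app x₂ x₀)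
  /-- `bar₁ f g h xs (s z) ⇝ h xs (λ x. bar f g h (xs :: x))`, in the context `z, xs, h, g, f` -/
  | bar₁_succ : Rule (Γ := [.nat, .list, tyH, tyG, tyOmega])
      (Term.bar₁ x₄ x₃ x₂ x₁ (Term.succ x₀))
      (.app (.app x₂ x₁)
        (.lam (Term.bar (.var (.succ (.succ (.succ (.succ (.succ .zero)))))) x₄ x₃
          (Term.snoc x₂ x₀))))

/-- Values: `λ x. r`, constructors applied to values, and function symbols applied to fewer values
than their arity (every function symbol has a positive arity). -/
inductive IsValue : ∀ {ρ : Ty}, Term [] ρ → Prop where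
  | lam {ρ τ : Ty} (r : Term [ρ] τ) : IsValue (.lam r)
  | con {δs : List Ty} {δ : Ty} (c : Con δs δ) : IsValue (.con c)
  | con_app {ρ τ : Ty} {t : Term [] (.arr ρ τ)} {v : Term [] ρ} :
      t.isConApp → IsValue t → IsValue v → IsValue (.app t v)
  | fn {ρs : List Ty} {ρ : Ty} (f : Fn ρs ρ) : IsValue (.fn f)
  | fn_app {ρ τ : Ty} {t : Term [] (.arr ρ τ)} {v : Term [] ρ} :
      1 < t.missing → IsValue t → IsValue v → IsValue (.app t v)

/-- `Eval e c v`: the closed term `e` evaluates to the value `v` in `c` rewrite steps. -/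
inductive Eval : ∀ {ρ : Ty}, Term [] ρ → ℕ → Term [] ρ → Prop where
  | val {ρ : Ty} {v : Term [] ρ} : IsValue v → Eval v 0 v
  | beta {ρ τ : Ty} {r : Term [ρ] τ} {u : Term [] ρ} {c : ℕ} {v : Term [] τ} :
      IsValue u → Eval (r.inst u) c v → Eval (.app (.lam r) u) (c + 1) v
  | rule {Γ : List Ty} {ρ : Ty} {l r : Term Γ ρ} {θ : ∀ {τ : Ty}, Var Γ τ → Term [] τ}
      {c : ℕ} {v : Term [] ρ} :
      Rule l r → (∀ {τ : Ty} (x : Var Γ τ), IsValue (θ x)) →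
      Eval (r.subst θ) c v → Eval (l.subst θ) (c + 1) v
  | app {ρ τ : Ty} {e u : Term [] (.arr ρ τ)} {e' v : Term [] ρ} {w : Term [] τ}
      {c₀ c₁ c₂ : ℕ} :
      ¬ (IsValue e ∧ IsValue e') →
      Eval e c₀ u → Eval e' c₁ v → Eval (.app u v) c₂ w → Eval (.app e e') (c₀ + c₁ + c₂) w

/-! ## The monadic metalanguage and the translation -/

/-- Types of the metalanguage: the type `γ` of costs, the two base types, products and functions. -/
inductive MTy : Type where
  | gamma : MTy
  | nat : MTy
  | list : MTy
  | prod : MTy → MTy → MTy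
  | arr : MTy → MTy → MTy

/-- The translation of types, `[ρ → τ] = [ρ] → γ × [τ]`. -/
@[reducible]
def Ty.tr : Ty → MTy
  | .nat => .nat
  | .list => .list
  | .arr ρ τ => .arr ρ.tr (.prod .gamma τ.tr)

/-- `mArrows [ρ₁, …, ρₖ] τ` is `[ρ₁] → ⋯ → [ρₖ] → τ`. -/
@[reducible]
def mArrows : List Ty → MTy → MTy
  | [], τ => τ
  | σ :: σs, τ => .arr σ.tr (mArrows σs τ)

/-- Terms of the metalanguage. -/
inductive MTerm : List MTy → MTy → Type where
  | iota {Γ : List MTy} : MTerm Γ .gamma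
  | inc {Γ : List MTy} : MTerm Γ .gamma → MTerm Γ .gamma
  | com {Γ : List MTy} : MTerm Γ .gamma → MTerm Γ .gamma → MTerm Γ .gamma → MTerm Γ .gamma
  | var {Γ : List MTy} {τ : MTy} : Var Γ τ → MTerm Γ τ
  | con {Γ : List MTy} {δs : List Ty} {δ : Ty} : Con δs δ → MTerm Γ (mArrows δs δ.tr)
  | fn {Γ : List MTy} {ρs : List Ty} {ρ : Ty} :
      Fn ρs ρ → MTerm Γ (mArrows ρs (.prod .gamma ρ.tr))
  | lam {Γ : List MTy} {σ τ : MTy} : MTerm (σ :: Γ) τ → MTerm Γ (.arr σ τ)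
  | app {Γ : List MTy} {σ τ : MTy} : MTerm Γ (.arr σ τ) → MTerm Γ σ → MTerm Γ τ
  | pair {Γ : List MTy} {σ τ : MTy} : MTerm Γ σ → MTerm Γ τ → MTerm Γ (.prod σ τ)
  | fst {Γ : List MTy} {σ τ : MTy} : MTerm Γ (.prod σ τ) → MTerm Γ σ
  | snd {Γ : List MTy} {σ τ : MTy} : MTerm Γ (.prod σ τ) → MTerm Γ τ

namespace MTerm

/-- `λ* x. r := (ι, λ x. r)` -/
def lamStar {Γ : List MTy} {σ τ : MTy} (r : MTerm (σ :: Γ) τ) :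
    MTerm Γ (.prod .gamma (.arr σ τ)) := .pair .iota (.lam r)

/-- Variables by their de Bruijn index. -/
abbrev y₀ {Γ : List MTy} {ρ : MTy} : MTerm (ρ :: Γ) ρ := .var .zero
abbrev y₁ {Γ : List MTy} {ρ σ : MTy} : MTerm (σ :: ρ :: Γ) ρ := .var (.succ .zero)
abbrev y₂ {Γ : List MTy} {ρ σ τ : MTy} : MTerm (τ :: σ :: ρ :: Γ) ρ :=
  .var (.succ (.succ .zero))
abbrev y₃ {Γ : List MTy} {ρ σ τ υ : MTy} : MTerm (υ :: τ :: σ :: ρ :: Γ) ρ :=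
  .var (.succ (.succ (.succ .zero)))
abbrev y₄ {Γ : List MTy} {ρ σ τ υ ν : MTy} : MTerm (ν :: υ :: τ :: σ :: ρ :: Γ) ρ :=
  .var (.succ (.succ (.succ (.succ .zero))))

end MTerm

open MTerm in
/-- `[c] := λ* x₁, …, xₘ. (ι, c x₁ ⋯ xₘ)` -/
def Con.tr {Γ : List MTy} : ∀ {δs : List Ty} {δ : Ty}, Con δs δ →
    MTerm Γ (.prod .gamma (arrows δs δ).tr)
  | _, _, .zero => .pair .iota (.con .zero)
  | _, _, .succ => lamStar (.pair .iota (.app (.con .succ) y₀))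
  | _, _, .nil => .pair .iota (.con .nil)
  | _, _, .snoc => lamStar (lamStar (.pair .iota (.app (.app (.con .snoc) y₁) y₀)))

open MTerm in
/-- `[f] := λ* x₁, …, xₙ. f x₁ ⋯ xₙ` -/
def Fn.tr {Γ : List MTy} : ∀ {ρs : List Ty} {ρ : Ty}, Fn ρs ρ →
    MTerm Γ (.prod .gamma (arrows ρs ρ).tr)
  | _, _, .fold ρ =>
      lamStar (lamStar (lamStar (.app (.app (.app (.fn (.fold ρ)) y₂) y₁) y₀)))
  | _, _, .plus => lamStar (lamStar (.app (.app (.fn .plus) y₁) y₀))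
  | _, _, .times => lamStar (lamStar (.app (.app (.fn .times) y₁) y₀))
  | _, _, .less => lamStar (lamStar (.app (.app (.fn .less) y₁) y₀))
  | _, _, .len => lamStar (.app (.fn .len) y₀)
  | _, _, .ext => lamStar (lamStar (.app (.app (.fn .ext) y₁) y₀))
  | _, _, .bar =>
      lamStar (lamStar (lamStar (lamStar (.app (.app (.app (.app (.fn .bar) y₃) y₂) y₁) y₀))))
  | _, _, .bar₁ =>
      lamStar (lamStar (lamStar (lamStar (lamStar
        (.app (.app (.app (.app (.app (.fn .bar₁) y₄) y₃) y₂) y₁) y₀)))))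

/-- The translation of variables. -/
def Var.tr : ∀ {Γ : List Ty} {ρ : Ty}, Var Γ ρ → Var (Γ.map Ty.tr) ρ.tr
  | _, _, .zero => .zero
  | _, _, .succ x => .succ x.tr

/-- The translation of `Γ ⊢ t : ρ` to `[Γ] ⊢ [t] : γ × [ρ]`. -/
def Term.tr : ∀ {Γ : List Ty} {ρ : Ty}, Term Γ ρ → MTerm (Γ.map Ty.tr) (.prod .gamma ρ.tr)
  | _, _, .var x => .pair .iota (.var x.tr)
  | _, _, .con c => c.tr
  | _, _, .fn f => f.tr
  | _, _, .lam t => MTerm.lamStar (.pair (.inc t.tr.fst) t.tr.snd)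
  | _, _, .app t s =>
      .pair (.com t.tr.fst s.tr.fst (MTerm.app t.tr.snd s.tr.snd).fst)
        (MTerm.app t.tr.snd s.tr.snd).snd

/-! ## The total continuous functionals, in the presentation through limit spaces -/

/-- A limit space (in the sense of Kuratowski): a set with a notion of convergent sequence. -/
structure LimitSpace : Type 1 where
  carrier : Type
  conv : (ℕ → carrier) → carrier → Prop
  conv_const : ∀ x, conv (fun _ => x) x
  conv_subseq : ∀ {u : ℕ → carrier} {x : carrier} {φ : ℕ → ℕ},
    conv u x → StrictMono φ → conv (fun n => u (φ n)) x
  conv_of_subseq : ∀ {u : ℕ → carrier} {x : carrier},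
    (∀ φ : ℕ → ℕ, StrictMono φ → ∃ ψ : ℕ → ℕ, StrictMono ψ ∧ conv (fun n => u (φ (ψ n))) x) →
    conv u x

namespace LimitSpace

theorem conv_tendsto (X : LimitSpace) {u : ℕ → X.carrier} {x : X.carrier} {θ : ℕ → ℕ}
    (hu : X.conv u x) (hθ : Tendsto θ atTop atTop) : X.conv (fun n => u (θ n)) x := by
  refine X.conv_of_subseq fun φ hφ => ?_
  obtain ⟨ψ, hψ, h⟩ := strictMono_subseq_of_tendsto_atTop (hθ.comp hφ.tendsto_atTop)
  exact ⟨ψ, hψ, X.conv_subseq hu h⟩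

theorem conv_congr (X : LimitSpace) {u v : ℕ → X.carrier} {x : X.carrier}
    (h : ∀ᶠ n in atTop, u n = v n) (hu : X.conv u x) : X.conv v x := by
  obtain ⟨N, hN⟩ := eventually_atTop.1 h
  refine X.conv_of_subseq fun φ hφ => ⟨fun n => n + N, fun a b hab => by simpa using hab, ?_⟩
  have h1 : (fun n => v (φ (n + N))) = fun n => u (φ (n + N)) := by
    funext n
    exact (hN _ (le_trans (Nat.le_add_left _ _) (hφ.id_le _))).symm
  rw [h1]
  exact X.conv_subseq hu (fun a b hab => hφ (by simpa using hab))

/-- A set with the discrete limit structure: convergent means eventually constant. -/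
@[reducible]
def disc (A : Type) : LimitSpace where
  carrier := A
  conv u x := ∀ᶠ n in atTop, u n = x
  conv_const x := Eventually.of_forall fun _ => rfl
  conv_subseq hu hφ := hφ.tendsto_atTop.eventually hu
  conv_of_subseq h := by
    by_contra hc
    obtain ⟨φ, hφ, hne⟩ := extraction_of_frequently_atTop (not_eventually.1 hc)
    obtain ⟨ψ, -, hψ⟩ := h φ hφ
    obtain ⟨n, hn⟩ := hψ.exists
    exact hne _ hn

/-- The product of limit spaces. -/
@[reducible]
def prod (X Y : LimitSpace) : LimitSpace where
  carrier := X.carrier × Y.carrier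
  conv u x := X.conv (fun n => (u n).1) x.1 ∧ Y.conv (fun n => (u n).2) x.2
  conv_const x := ⟨X.conv_const _, Y.conv_const _⟩
  conv_subseq hu hφ := ⟨X.conv_subseq hu.1 hφ, Y.conv_subseq hu.2 hφ⟩
  conv_of_subseq h :=
    ⟨X.conv_of_subseq fun φ hφ => let ⟨ψ, hψ, h1⟩ := h φ hφ; ⟨ψ, hψ, h1.1⟩,
     Y.conv_of_subseq fun φ hφ => let ⟨ψ, hψ, h1⟩ := h φ hφ; ⟨ψ, hψ, h1.2⟩⟩

/-- A function between limit spaces is continuous if it preserves limits of sequences. -/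
def IsCont (X Y : LimitSpace) (f : X.carrier → Y.carrier) : Prop :=
  ∀ (u : ℕ → X.carrier) (x : X.carrier), X.conv u x → Y.conv (fun n => f (u n)) (f x)

/-- The function space: all continuous functions, with continuous convergence. -/
@[reducible]
def fun' (X Y : LimitSpace) : LimitSpace where
  carrier := {f : X.carrier → Y.carrier // IsCont X Y f}
  conv F f := ∀ (u : ℕ → X.carrier) (x : X.carrier), X.conv u x →
    Y.conv (fun n => (F n).1 (u n)) (f.1 x)
  conv_const f := f.2
  conv_subseq {F f φ} hF hφ u x hu := by
    let θ : ℕ → ℕ := fun m => Nat.findGreatest (fun n => φ n ≤ m) m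
    have hθφ : ∀ n, θ (φ n) = n := fun n => by
      refine le_antisymm ?_ (Nat.le_findGreatest (hφ.id_le n) le_rfl)
      have h0 : φ (θ (φ n)) ≤ φ n :=
        Nat.findGreatest_spec (P := fun k => φ k ≤ φ n) (hφ.id_le n) le_rfl
      exact hφ.le_iff_le.1 h0
    have hθ : Tendsto θ atTop atTop := tendsto_atTop.2 fun n =>
      eventually_atTop.2 ⟨φ n, fun m hm => Nat.le_findGreatest ((hφ.id_le n).trans hm) hm⟩
    have h1 := Y.conv_subseq (hF _ _ (X.conv_tendsto hu hθ)) hφ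
    simpa only [hθφ] using h1
  conv_of_subseq {F f} h u x hu := Y.conv_of_subseq fun φ hφ => by
    obtain ⟨ψ, hψ, h1⟩ := h φ hφ
    exact ⟨ψ, hψ, h1 _ _ (X.conv_subseq hu (hφ.comp hψ))⟩

/-- Every function on a discrete space is continuous. -/
def ofDisc {A : Type} {Y : LimitSpace} (f : A → Y.carrier) : (fun' (disc A) Y).carrier :=
  ⟨f, fun _ x hu => Y.conv_congr (hu.mono fun _ hn => by rw [hn]) (Y.conv_const (f x))⟩

theorem conv_ofDisc {A : Type} {Y : LimitSpace} {F : ℕ → A → Y.carrier} {f : A → Y.carrier}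
    (h : ∀ a, Y.conv (fun n => F n a) (f a)) :
    (fun' (disc A) Y).conv (fun n => ofDisc (F n)) (ofDisc f) :=
  fun _ x hu => Y.conv_congr (hu.mono fun _ hn => by simp only [ofDisc]; rw [hn]) (h x)

end LimitSpace

open LimitSpace

/-- The interpretation of the types of the metalanguage. -/
@[reducible]
def MTy.den : MTy → LimitSpace
  | .gamma => disc ℕ
  | .nat => disc ℕ
  | .list => disc (List ℕ)
  | .prod σ τ => LimitSpace.prod σ.den τ.den
  | .arr σ τ => LimitSpace.fun' σ.den τ.den

/-- The elements of the interpretation of a type of the metalanguage. -/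
abbrev MTy.El (σ : MTy) : Type := σ.den.carrier

/-- Denotations of target terms of type `ρ`: pairs of a cost and an element of `[ρ]`. -/
abbrev Ty.Comp (ρ : Ty) : Type := ℕ × ρ.tr.El

/-- The limit space of these pairs. -/
abbrev Ty.compSpace (ρ : Ty) : LimitSpace := LimitSpace.prod (disc ℕ) ρ.tr.den

/-- Application in the model of an element of a translated function type. -/
def ap {ρ τ : Ty} (f : (Ty.arr ρ τ).tr.El) (a : ρ.tr.El) : τ.Comp := f.1 a

/-- Adding a constant to the cost component. -/
def cplus {A : Type} (c : ℕ) (a : ℕ × A) : ℕ × A := (c + a.1, a.2)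

/-- Monadic application `f ∘ a`. -/
def circ {ρ τ : Ty} (f : (Ty.arr ρ τ).Comp) (a : ρ.Comp) : τ.Comp :=
  (f.1 + a.1 + (ap f.2 a.2).1, (ap f.2 a.2).2)

/-- An element of a translated function type whose argument type is `Nat`. -/
def natFun {τ : Ty} (f : ℕ → τ.Comp) : (Ty.arr .nat τ).tr.El :=
  ofDisc (A := ℕ) (Y := τ.compSpace) f

theorem conv_ap {ρ τ : Ty} {F : ℕ → (Ty.arr ρ τ).tr.El} {f : (Ty.arr ρ τ).tr.El}
    {u : ℕ → ρ.tr.El} {x : ρ.tr.El} (hF : (Ty.arr ρ τ).tr.den.conv F f)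
    (hu : ρ.tr.den.conv u x) : τ.compSpace.conv (fun n => ap (F n) (u n)) (ap f x) :=
  hF u x hu

theorem conv_cplus {ρ : Ty} {c : ℕ → ℕ} {d : ℕ} {u : ℕ → ρ.Comp} {x : ρ.Comp}
    (hc : ∀ᶠ n in atTop, c n = d) (hu : ρ.compSpace.conv u x) :
    ρ.compSpace.conv (fun n => cplus (c n) (u n)) (cplus d x) := by
  obtain ⟨h1, h2⟩ := hu
  refine ⟨?_, h2⟩
  filter_upwards [hc, (show ∀ᶠ n in atTop, (u n).1 = x.1 from h1)] with n a b
  simp only [cplus, a, b]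

theorem conv_circ {ρ τ : Ty} {F : ℕ → (Ty.arr ρ τ).Comp} {f : (Ty.arr ρ τ).Comp}
    {u : ℕ → ρ.Comp} {x : ρ.Comp} (hF : (Ty.arr ρ τ).compSpace.conv F f)
    (hu : ρ.compSpace.conv u x) :
    τ.compSpace.conv (fun n => circ (F n) (u n)) (circ f x) := by
  obtain ⟨h1, h2⟩ := hF
  obtain ⟨h3, h4⟩ := hu
  obtain ⟨h5, h6⟩ := conv_ap h2 h4
  refine ⟨?_, h6⟩
  filter_upwards [(show ∀ᶠ n in atTop, (F n).1 = f.1 from h1),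
    (show ∀ᶠ n in atTop, (u n).1 = x.1 from h3),
    (show ∀ᶠ n in atTop, (ap (F n).2 (u n).2).1 = (ap f.2 x.2).1 from h5)] with n a b c
  simp only [circ, a, b, c]

/-! ### The interpretation of `fold` -/

/-- `fold(b, h, []) = 1 ⊕ (0, b)` and `fold(b, h, a * n) = 1 ⊕ (h n ∘ fold(b, h, a))`. -/
def foldVal {ρ : Ty} (b : ρ.tr.El) (h : (Ty.arr .nat (.arr ρ ρ)).tr.El) (a : List ℕ) : ρ.Comp :=
  a.foldl (fun r n => cplus 1 (circ (ap (ρ := .nat) h n) r)) (cplus 1 (0, b))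

theorem foldVal_nil {ρ : Ty} (b : ρ.tr.El) (h : (Ty.arr .nat (.arr ρ ρ)).tr.El) :
    foldVal b h [] = cplus 1 (0, b) := rfl

theorem foldVal_snoc {ρ : Ty} (b : ρ.tr.El) (h : (Ty.arr .nat (.arr ρ ρ)).tr.El) (a : List ℕ)
    (n : ℕ) : foldVal b h (a ++ [n]) = cplus 1 (circ (ap (ρ := .nat) h n) (foldVal b h a)) := by
  simp [foldVal]

theorem conv_foldVal {ρ : Ty} {b : ℕ → ρ.tr.El} {b' : ρ.tr.El}
    {h : ℕ → (Ty.arr .nat (.arr ρ ρ)).tr.El} {h' : (Ty.arr .nat (.arr ρ ρ)).tr.El}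
    (hb : ρ.tr.den.conv b b') (hh : (Ty.arr .nat (.arr ρ ρ)).tr.den.conv h h') (a : List ℕ) :
    ρ.compSpace.conv (fun n => foldVal (b n) (h n) a) (foldVal b' h' a) := by
  induction a using List.reverseRecOn with
  | nil =>
    exact conv_cplus (Eventually.of_forall fun _ => rfl) ⟨(disc ℕ).conv_const (0 : ℕ), hb⟩
  | append_singleton a m ih =>
    simp only [foldVal_snoc]
    exact conv_cplus (Eventually.of_forall fun _ => rfl)
      (conv_circ (conv_ap hh (Ty.nat.tr.den.conv_const m)) ih)

/-! ### The interpretation of bar recursion -/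

/-- The element `λ i. (1, âᵢ)` of the translation of `Nat → Nat`. -/
def extVal (a : List ℕ) : (Ty.arr .nat .nat).tr.El := natFun (τ := .nat) fun i => ((1 : ℕ), hat a i)

/-- `ω(λ i. (1, âᵢ))`, a pair of a cost and a number. -/
def omegaAt (ω : tyOmega.tr.El) (a : List ℕ) : ℕ × ℕ :=
  ap (ρ := .arr .nat .nat) (τ := .nat) ω (extVal a)

/-- `b` is an immediate successor `a * n` of a node `a` at which bar recursion has not stopped. -/
def BarStep (ω : tyOmega.tr.El) (b a : List ℕ) : Prop :=
  ¬ (omegaAt ω a).2 < a.length ∧ ∃ n, b = a ++ [n]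

theorem barStep_wf (ω : tyOmega.tr.El) : WellFounded (BarStep ω) := by
  rw [wellFounded_iff_isEmpty_descending_chain]
  refine ⟨fun ⟨f, hf⟩ => ?_⟩
  have hlen : ∀ n, (f n).length = (f 0).length + n := by
    intro n
    induction n with
    | zero => rfl
    | succ n ih =>
      obtain ⟨m, hm⟩ := (hf n).2
      rw [hm, List.length_append, ih]
      simp [add_assoc]
  have hpre : ∀ k n, f n <+: f (n + k) := by
    intro k n
    induction k with
    | zero => exact List.prefix_refl _
    | succ k ih =>
      obtain ⟨m, hm⟩ := (hf (n + k)).2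
      exact ih.trans (by rw [← add_assoc, hm]; exact List.prefix_append _ _)
  have hstab : ∀ i n, i + 1 ≤ n → hat (f n) i = hat (f (i + 1)) i := by
    intro i n hn
    obtain ⟨k, rfl⟩ := Nat.exists_eq_add_of_le hn
    obtain ⟨t, ht⟩ := hpre k (i + 1)
    have hi : i < (f (i + 1)).length := by rw [hlen]; omega
    simp only [hat]
    rw [← ht, List.getD_append _ _ _ _ hi]
  have hconv : (Ty.arr .nat .nat).tr.den.conv (fun n => extVal (f n))
      (natFun (τ := .nat) fun i => ((1 : ℕ), hat (f (i + 1)) i)) := by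
    refine conv_ofDisc fun i => ⟨(disc ℕ).conv_const (1 : ℕ), ?_⟩
    exact eventually_atTop.2 ⟨i + 1, fun n hn => hstab i n hn⟩
  have h2 := (conv_ap (ρ := .arr .nat .nat) (τ := .nat)
    ((tyOmega).tr.den.conv_const ω) hconv).2
  obtain ⟨N, hN⟩ := eventually_atTop.1 h2
  let k : ℕ := (ap (ρ := .arr .nat .nat) (τ := .nat) ω
    (natFun (τ := .nat) fun i => ((1 : ℕ), hat (f (i + 1)) i))).2
  have hk : (omegaAt ω (f (N + k + 1))).2 = k := hN (N + k + 1) (by omega)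
  refine (hf (N + k + 1)).1 ?_
  rw [hk, hlen]
  omega

/-- Bar recursion with costs, by recursion over the well-founded tree of nodes at which it has not
stopped; see `barVal_eq` for the defining equation. -/
noncomputable def barVal (ω : tyOmega.tr.El) (g : tyG.tr.El) (h : tyH.tr.El) :
    List ℕ → ℕ × ℕ :=
  (barStep_wf ω).fix fun a rec =>
    cplus (4 + (omegaAt ω a).1)
      (if hs : (omegaAt ω a).2 < a.length then ap (ρ := .list) (τ := .nat) g a
       else circ (ρ := .arr .nat .nat) (τ := .nat) (ap (ρ := .list) h a)
        (0, natFun (τ := .nat) fun n => cplus 1 (rec (a ++ [n]) ⟨hs, n, rfl⟩)))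

theorem barVal_eq (ω : tyOmega.tr.El) (g : tyG.tr.El) (h : tyH.tr.El) (a : List ℕ) :
    barVal ω g h a =
      cplus (4 + (omegaAt ω a).1)
        (if (omegaAt ω a).2 < a.length then ap (ρ := .list) (τ := .nat) g a
         else circ (ρ := .arr .nat .nat) (τ := .nat) (ap (ρ := .list) h a)
          (0, natFun (τ := .nat) fun n => cplus 1 (barVal ω g h (a ++ [n])))) := by
  rw [barVal, WellFounded.fix_eq]
  by_cases hs : (omegaAt ω a).2 < a.length
  · rw [dif_pos hs, if_pos hs]
  · rw [dif_neg hs, if_neg hs]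

/-- The interpretation of the auxiliary symbol `bar₁`. -/
noncomputable def bar₁Val (ω : tyOmega.tr.El) (g : tyG.tr.El) (h : tyH.tr.El) (a : List ℕ) :
    ℕ → ℕ × ℕ
  | 0 => cplus 1 (ap (ρ := .list) (τ := .nat) g a)
  | _ + 1 => cplus 1 (circ (ρ := .arr .nat .nat) (τ := .nat) (ap (ρ := .list) h a)
      (0, natFun (τ := .nat) fun n => cplus 1 (barVal ω g h (a ++ [n]))))

section BarCont

variable {ω : ℕ → tyOmega.tr.El} {ω' : tyOmega.tr.El} {g : ℕ → tyG.tr.El} {g' : tyG.tr.El}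
  {h : ℕ → tyH.tr.El} {h' : tyH.tr.El}

theorem conv_barTail (hh : tyH.tr.den.conv h h') (a : List ℕ)
    (ih : ∀ m, Ty.nat.compSpace.conv (fun n => barVal (ω n) (g n) (h n) (a ++ [m]))
      (barVal ω' g' h' (a ++ [m]))) :
    Ty.nat.compSpace.conv
      (fun k => circ (ρ := .arr .nat .nat) (τ := .nat) (ap (ρ := .list) (h k) a)
        (0, natFun (τ := .nat) fun n => cplus 1 (barVal (ω k) (g k) (h k) (a ++ [n]))))
      (circ (ρ := .arr .nat .nat) (τ := .nat) (ap (ρ := .list) h' a)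
        (0, natFun (τ := .nat) fun n => cplus 1 (barVal ω' g' h' (a ++ [n])))) := by
  refine conv_circ (conv_ap hh (Ty.list.tr.den.conv_const a)) ⟨(disc ℕ).conv_const (0 : ℕ), ?_⟩
  exact conv_ofDisc fun m => conv_cplus (ρ := .nat) (Eventually.of_forall fun _ => rfl) (ih m)

theorem conv_barVal (hω : tyOmega.tr.den.conv ω ω') (hg : tyG.tr.den.conv g g')
    (hh : tyH.tr.den.conv h h') (a : List ℕ) :
    Ty.nat.compSpace.conv (fun n => barVal (ω n) (g n) (h n) a) (barVal ω' g' h' a) := by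
  induction a using (barStep_wf ω').induction with
  | _ a ih =>
    obtain ⟨h1, h2⟩ := conv_ap (ρ := .arr .nat .nat) (τ := .nat) hω
      ((Ty.arr .nat .nat).tr.den.conv_const (extVal a))
    have h1' : ∀ᶠ n in atTop, (omegaAt (ω n) a).1 = (omegaAt ω' a).1 := h1
    have h2' : ∀ᶠ n in atTop, (omegaAt (ω n) a).2 = (omegaAt ω' a).2 := h2
    simp only [barVal_eq _ _ _ a]
    refine conv_cplus (ρ := .nat) (h1'.mono fun n hn => by rw [hn]) ?_
    by_cases hs : (omegaAt ω' a).2 < a.length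
    · rw [if_pos hs]
      refine Ty.nat.compSpace.conv_congr (h2'.mono fun n hn => ?_)
        (conv_ap hg (Ty.list.tr.den.conv_const a))
      rw [hn, if_pos hs]
    · rw [if_neg hs]
      refine Ty.nat.compSpace.conv_congr (h2'.mono fun n hn => ?_)
        (conv_barTail hh a fun m => ih _ ⟨hs, m, rfl⟩)
      rw [hn, if_neg hs]

theorem conv_bar₁Val (hω : tyOmega.tr.den.conv ω ω') (hg : tyG.tr.den.conv g g')
    (hh : tyH.tr.den.conv h h') (a : List ℕ) (m : ℕ) :
    Ty.nat.compSpace.conv (fun n => bar₁Val (ω n) (g n) (h n) a m) (bar₁Val ω' g' h' a m) := by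
  cases m with
  | zero =>
    exact conv_cplus (ρ := .nat) (Eventually.of_forall fun _ => rfl)
      (conv_ap hg (Ty.list.tr.den.conv_const a))
  | succ m =>
    exact conv_cplus (ρ := .nat) (Eventually.of_forall fun _ => rfl)
      (conv_barTail hh a fun k => conv_barVal hω hg hh _)

end BarCont

/-! ### The interpretation of the metalanguage -/

/-- The interpretation of the constructors. -/
def Con.den : ∀ {δs : List Ty} {δ : Ty}, Con δs δ → (mArrows δs δ.tr).El
  | _, _, .zero => (0 : ℕ)
  | _, _, .succ => ofDisc (A := ℕ) (Y := disc ℕ) fun n => n + 1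
  | _, _, .nil => ([] : List ℕ)
  | _, _, .snoc => ofDisc (A := List ℕ) (Y := fun' (disc ℕ) (disc (List ℕ))) fun a =>
      ofDisc (A := ℕ) (Y := disc (List ℕ)) fun n => a ++ [n]

/-- The interpretation of a binary operation on numbers, at cost `1`. -/
def binDen (f : ℕ → ℕ → ℕ) : (mArrows [.nat, .nat] (.prod .gamma .nat)).El :=
  ofDisc (A := ℕ) (Y := fun' (disc ℕ) Ty.nat.compSpace) fun m =>
    ofDisc (A := ℕ) (Y := Ty.nat.compSpace) fun n => ((1 : ℕ), f m n)

/-- The interpretation of the function symbols. -/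
noncomputable def Fn.den : ∀ {ρs : List Ty} {ρ : Ty}, Fn ρs ρ →
    (mArrows ρs (.prod .gamma ρ.tr)).El
  | _, _, .fold ρ =>
      ⟨fun b => ⟨fun h => ofDisc (A := List ℕ) (Y := ρ.compSpace) (foldVal b h),
        fun _ _ hh => conv_ofDisc fun a => conv_foldVal (ρ.tr.den.conv_const b) hh a⟩,
        fun _ _ hb _ _ hh => conv_ofDisc fun a => conv_foldVal hb hh a⟩
  | _, _, .plus => binDen fun m n => m + n
  | _, _, .times => binDen fun m n => m * n
  | _, _, .less => binDen fun m n => if m < n then 0 else 1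
  | _, _, .len => ofDisc (A := List ℕ) (Y := Ty.nat.compSpace) fun a => ((1 : ℕ), a.length)
  | _, _, .ext => ofDisc (A := List ℕ) (Y := fun' (disc ℕ) Ty.nat.compSpace) fun a => extVal a
  | _, _, .bar =>
      ⟨fun ω => ⟨fun g => ⟨fun h =>
        ofDisc (A := List ℕ) (Y := Ty.nat.compSpace) (barVal ω g h),
        fun _ _ hh => conv_ofDisc fun a =>
          conv_barVal (tyOmega.tr.den.conv_const ω) (tyG.tr.den.conv_const g) hh a⟩,
        fun _ _ hg _ _ hh => conv_ofDisc fun a =>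
          conv_barVal (tyOmega.tr.den.conv_const ω) hg hh a⟩,
        fun _ _ hω _ _ hg _ _ hh => conv_ofDisc fun a => conv_barVal hω hg hh a⟩
  | _, _, .bar₁ =>
      ⟨fun ω => ⟨fun g => ⟨fun h =>
        ofDisc (A := List ℕ) (Y := fun' (disc ℕ) Ty.nat.compSpace) fun a =>
          ofDisc (A := ℕ) (Y := Ty.nat.compSpace) (bar₁Val ω g h a),
        fun _ _ hh => conv_ofDisc fun a => conv_ofDisc fun m =>
          conv_bar₁Val (tyOmega.tr.den.conv_const ω) (tyG.tr.den.conv_const g) hh a m⟩,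
        fun _ _ hg _ _ hh => conv_ofDisc fun a => conv_ofDisc fun m =>
          conv_bar₁Val (tyOmega.tr.den.conv_const ω) hg hh a m⟩,
        fun _ _ hω _ _ hg _ _ hh => conv_ofDisc fun a => conv_ofDisc fun m =>
          conv_bar₁Val hω hg hh a m⟩

/-- The limit space of environments for a context of the metalanguage. -/
@[reducible]
def envSpace : List MTy → LimitSpace
  | [] => disc Unit
  | σ :: Γ => LimitSpace.prod σ.den (envSpace Γ)

/-- The interpretation of variables, as continuous functions of the environment. -/
def Var.den : ∀ {Γ : List MTy} {τ : MTy}, Var Γ τ → (fun' (envSpace Γ) τ.den).carrier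
  | _, _, .zero => ⟨fun ξ => ξ.1, fun _ _ hu => hu.1⟩
  | _, _, .succ x => ⟨fun ξ => x.den.1 ξ.2, fun _ _ hu => x.den.2 _ _ hu.2⟩

/-- The interpretation `⟦t⟧ξ` of a term of the metalanguage, continuous in the environment `ξ`.
The cost structure is `ε = 0`, `inc c = c + 1`, `com (c₀, c₁, c₂) = c₀ + c₁ + c₂`. -/
noncomputable def MTerm.den : ∀ {Γ : List MTy} {τ : MTy}, MTerm Γ τ →
    (fun' (envSpace Γ) τ.den).carrier
  | _, _, .iota => ⟨fun _ => (0 : ℕ), fun _ _ _ => (disc ℕ).conv_const (0 : ℕ)⟩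
  | _, _, .inc t => ⟨fun ξ => Nat.succ (t.den.1 ξ), fun u x hu =>
      (show ∀ᶠ n in atTop, t.den.1 (u n) = t.den.1 x from t.den.2 u x hu).mono
        fun _ hn => congrArg Nat.succ hn⟩
  | _, _, .com r s t =>
      ⟨fun ξ => Nat.add (Nat.add (r.den.1 ξ) (s.den.1 ξ)) (t.den.1 ξ), fun u x hu => by
        filter_upwards [(show ∀ᶠ n in atTop, r.den.1 (u n) = r.den.1 x from r.den.2 u x hu),
          (show ∀ᶠ n in atTop, s.den.1 (u n) = s.den.1 x from s.den.2 u x hu),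
          (show ∀ᶠ n in atTop, t.den.1 (u n) = t.den.1 x from t.den.2 u x hu)] with n a b c
        rw [a, b, c]⟩
  | _, _, .var x => x.den
  | _, _, .con (δs := δs) (δ := δ) c =>
      ⟨fun _ => c.den, fun _ _ _ => (mArrows δs δ.tr).den.conv_const c.den⟩
  | _, _, .fn (ρs := ρs) (ρ := ρ) f =>
      ⟨fun _ => f.den, fun _ _ _ => (mArrows ρs (.prod .gamma ρ.tr)).den.conv_const f.den⟩
  | Γ, _, .lam t =>
      ⟨fun ξ => ⟨fun a => t.den.1 (a, ξ),
        fun _ _ hu => t.den.2 _ _ ⟨hu, (envSpace Γ).conv_const ξ⟩⟩,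
        fun _ _ hξ _ _ hu => t.den.2 _ _ ⟨hu, hξ⟩⟩
  | _, _, .app t s =>
      ⟨fun ξ => (t.den.1 ξ).1 (s.den.1 ξ), fun u x hu => t.den.2 u x hu _ _ (s.den.2 u x hu)⟩
  | _, _, .pair s t =>
      ⟨fun ξ => (s.den.1 ξ, t.den.1 ξ), fun u x hu => ⟨s.den.2 u x hu, t.den.2 u x hu⟩⟩
  | _, _, .fst t => ⟨fun ξ => (t.den.1 ξ).1, fun u x hu => (t.den.2 u x hu).1⟩
  | _, _, .snd t => ⟨fun ξ => (t.den.1 ξ).2, fun u x hu => (t.den.2 u x hu).2⟩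

/-- The denotation `⟦[e]⟧` of a closed term `e : ρ` of the target language: a cost, and an element
of the interpretation of `[ρ]`. -/
noncomputable def denote {ρ : Ty} (e : Term [] ρ) : ρ.Comp := e.tr.den.1 ()

end BarCost

/-! The proof uses a logical relation between syntax and model that counts costs exactly. `Rel`
links values with elements of the model: at base types the value is the numeral; at an arrow type,
applying the value to a related argument evaluates at precisely the cost that the model predicts,
with a related result. `RelC` extends this to closed terms and pairs of a cost and an element. The
fundamental lemma `relC_subst`, specialised to closed terms, gives the theorem.

Abstraction and application only require matching bookkeeping: a β-step is paid for by the `1 ⊕` in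
the denotation of `λ` (`rel_lam`), and `circ` adds the same three costs as the evaluation rule for
applications (`RelC.app`). That rule excludes a pair of values, where it would be circular;
`Eval.app'` removes this side condition, because a value evaluates only to itself and at cost `0`.

The remaining content lies in the function symbols. Applied to too few arguments they are values and
free on both sides; applied to all of them, they must be followed through their rules. For `fold`
this is induction on the list. For `bar` it is induction along `BarStep ω`, whose well-foundedness
`barStep_wf` comes from continuity: along an infinite branch the sequences `extVal` converge, so the
values of `ω` are eventually constant while the lengths grow without bound. Termination of syntactic
bar recursion is thus inherited from the model (`relC_bar`). -/

namespace BarCost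

open Filter LimitSpace

/-! ### Renaming and substitution calculus for typed de Bruijn terms -/

namespace Term

theorem liftRen_comp {Γ Δ Θ : List Ty} {σ : Ty} (r : ∀ {τ : Ty}, Var Γ τ → Var Δ τ)
    (s : ∀ {τ : Ty}, Var Δ τ → Var Θ τ) {τ : Ty} (x : Var (σ :: Γ) τ) :
    liftRen s (liftRen r x) = liftRen (fun y => s (r y)) x := by
  cases x <;> rfl

theorem rename_rename {Γ Δ Θ : List Ty} {ρ : Ty} (t : Term Γ ρ)
    (r : ∀ {τ : Ty}, Var Γ τ → Var Δ τ) (s : ∀ {τ : Ty}, Var Δ τ → Var Θ τ) :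
    rename s (rename r t) = rename (fun y => s (r y)) t := by
  induction t generalizing Δ Θ with
  | var x => rfl
  | con c => rfl
  | fn f => rfl
  | lam t ih =>
    simp only [rename, ih]
    congr 2
    funext τ x
    exact liftRen_comp r s x
  | app t s ih₁ ih₂ => simp only [rename, ih₁, ih₂]

theorem subst_rename {Γ Δ Θ : List Ty} {ρ : Ty} (t : Term Γ ρ)
    (r : ∀ {τ : Ty}, Var Γ τ → Var Δ τ) (θ : ∀ {τ : Ty}, Var Δ τ → Term Θ τ) :
    subst θ (rename r t) = subst (fun y => θ (r y)) t := by
  induction t generalizing Δ Θ with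
  | var x => rfl
  | con c => rfl
  | fn f => rfl
  | lam t ih =>
    simp only [rename, subst, ih]
    congr 2
    funext τ x
    cases x <;> rfl
  | app t s ih₁ ih₂ => simp only [rename, subst, ih₁, ih₂]

theorem rename_subst {Γ Δ Θ : List Ty} {ρ : Ty} (t : Term Γ ρ)
    (θ : ∀ {τ : Ty}, Var Γ τ → Term Δ τ) (r : ∀ {τ : Ty}, Var Δ τ → Var Θ τ) :
    rename r (subst θ t) = subst (fun y => rename r (θ y)) t := by
  induction t generalizing Δ Θ with
  | var x => rfl
  | con c => rfl
  | fn f => rfl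
  | lam t ih =>
    simp only [rename, subst, ih]
    congr 2
    funext τ x
    cases x with
    | zero => rfl
    | succ x =>
      simp only [liftSub, rename_rename]
      rfl
  | app t s ih₁ ih₂ => simp only [rename, subst, ih₁, ih₂]

theorem subst_subst {Γ Δ Θ : List Ty} {ρ : Ty} (t : Term Γ ρ)
    (θ : ∀ {τ : Ty}, Var Γ τ → Term Δ τ) (η : ∀ {τ : Ty}, Var Δ τ → Term Θ τ) :
    subst η (subst θ t) = subst (fun y => subst η (θ y)) t := by
  induction t generalizing Δ Θ with
  | var x => rfl
  | con c => rfl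
  | fn f => rfl
  | lam t ih =>
    simp only [subst, ih]
    congr 2
    funext τ x
    cases x with
    | zero => rfl
    | succ x =>
      simp only [liftSub, rename_subst, subst_rename]
  | app t s ih₁ ih₂ => simp only [subst, ih₁, ih₂]

theorem subst_var {Γ : List Ty} {ρ : Ty} (t : Term Γ ρ) : subst (fun x => .var x) t = t := by
  induction t with
  | var x => rfl
  | con c => rfl
  | fn f => rfl
  | @lam Γ ρ τ t ih =>
    simp only [subst]
    congr 1
    refine Eq.trans ?_ ih
    congr 1
    funext τ x
    cases x <;> rfl
  | app t s ih₁ ih₂ => simp only [subst, ih₁, ih₂]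

/-- Extend a substitution by a term for the most recently bound variable. -/
def scons {Γ Δ : List Ty} {σ : Ty} (u : Term Δ σ) (θ : ∀ {τ : Ty}, Var Γ τ → Term Δ τ) :
    ∀ {τ : Ty}, Var (σ :: Γ) τ → Term Δ τ
  | _, .zero => u
  | _, .succ x => θ x

/-- The substitution for the empty context. -/
def snil {Δ : List Ty} : ∀ {τ : Ty}, Var [] τ → Term Δ τ := fun x => nomatch x

theorem subst_single_rename {Γ : List Ty} {σ ρ : Ty} (u : Term Γ σ) (t : Term Γ ρ) :
    subst (single u) (rename .succ t) = t := by
  rw [subst_rename]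
  exact subst_var t

/-- Turns the contractum of a β-step on a substituted abstraction into a single simultaneous
substitution, the syntactic counterpart of extending an environment. The weakening in `liftSub` is
cancelled by `single`. -/
theorem inst_subst_liftSub {Γ Δ : List Ty} {σ ρ : Ty} (t : Term (σ :: Γ) ρ) (u : Term Δ σ)
    (θ : ∀ {τ : Ty}, Var Γ τ → Term Δ τ) :
    inst (subst (liftSub θ) t) u = subst (scons u θ) t := by
  rw [inst, subst_subst]
  congr 1
  funext τ x
  cases x with
  | zero => rfl
  | succ x => exact subst_single_rename u (θ x)

theorem subst_snil {ρ : Ty} (t : Term [] ρ) : subst snil t = t := by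
  refine Eq.trans ?_ (subst_var t)
  congr 1
  funext τ x
  cases x

theorem listNum_append {Γ : List Ty} (a : List ℕ) (n : ℕ) :
    (listNum (a ++ [n]) : Term Γ .list) = snoc (listNum a) (num n) := by
  simp [listNum]

end Term

open Term

/-! ### Values -/

theorem isValue_num (n : ℕ) : IsValue (num n) := by
  induction n with
  | zero => exact .con _
  | succ n ih => exact .con_app trivial (.con _) ih

theorem IsValue.snoc {t : Term [] .list} {s : Term [] .nat} (ht : IsValue t) (hs : IsValue s) :
    IsValue (Term.snoc t s) :=
  .con_app trivial (.con_app trivial (.con _) ht) hs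

theorem isValue_listNum (a : List ℕ) : IsValue (listNum a) := by
  induction a using List.reverseRecOn with
  | nil => exact .con _
  | append_singleton a n ih =>
    rw [listNum_append]
    exact ih.snoc (isValue_num n)

/-- What being a value means for an application. -/
def AppValue : ∀ {Γ : List Ty} {ρ : Ty}, Term Γ ρ → (∀ {τ : Ty}, Term Γ τ → Prop) → Prop
  | _, _, .app t v, P => (t.isConApp ∨ 1 < t.missing) ∧ P t ∧ P v
  | _, _, _, _ => True

/-- Inversion of `IsValue` with term and type kept general, so that the computed indices `arrows ρs
ρ` need not be unified with a concrete type. Concrete redexes are then handled by unfolding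
`AppValue`. -/
theorem IsValue.appValue {ρ : Ty} {v : Term [] ρ} (h : IsValue v) : AppValue v IsValue := by
  cases h with
  | lam | con | fn => trivial
  | con_app h₁ h₂ h₃ => exact ⟨.inl h₁, h₂, h₃⟩
  | fn_app h₁ h₂ h₃ => exact ⟨.inr h₁, h₂, h₃⟩

/-- A left-hand side supplies its function symbol with exactly arity many arguments: before the last
one `missing` is `1`, and the head is not a constructor. -/
theorem not_isValue_rule {Γ : List Ty} {ρ : Ty} {l r : Term Γ ρ} (h : Rule l r)
    (θ : ∀ {τ : Ty}, Var Γ τ → Term [] τ) : ¬ IsValue (l.subst θ) := by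
  intro hv
  have h' := hv.appValue
  cases h <;> simp [AppValue, subst, isConApp, missing] at h'

/-- β-redexes and rule redexes are not values, and an application that is a value has two values as
its parts, which the side condition of the application rule forbids. Only the reflexive rule
remains. -/
theorem Eval.eq_of_isValue {ρ : Ty} {e v : Term [] ρ} {c : ℕ} (h : Eval e c v)
    (he : IsValue e) : c = 0 ∧ v = e := by
  cases h with
  | val _ => exact ⟨rfl, rfl⟩
  | beta _ _ =>
    have h' := he.appValue
    simp [AppValue, isConApp, missing] at h'
  | rule hr _ _ => exact absurd he (not_isValue_rule hr _)
  | app hn _ _ _ => exact absurd he.appValue.2 hn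

/-- The evaluation rule for applications, without its side condition. -/
theorem Eval.app' {ρ τ : Ty} {e u : Term [] (.arr ρ τ)} {e' v : Term [] ρ} {w : Term [] τ}
    {c₀ c₁ c₂ : ℕ} (h₀ : Eval e c₀ u) (h₁ : Eval e' c₁ v) (h₂ : Eval (.app u v) c₂ w) :
    Eval (.app e e') (c₀ + c₁ + c₂) w := by
  -- For two values the first two evaluations are trivial, and the third is already the claim.
  by_cases h : IsValue e ∧ IsValue e'
  · obtain ⟨rfl, rfl⟩ := h₀.eq_of_isValue h.1
    obtain ⟨rfl, rfl⟩ := h₁.eq_of_isValue h.2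
    simpa using h₂
  · exact .app h h₀ h₁ h₂

/-! ### The logical relation -/

/-- The logical relation between values and elements of the model. -/
def Rel : ∀ {ρ : Ty}, Term [] ρ → ρ.tr.El → Prop
  | .nat, v, n => v = num n
  | .list, v, a => v = listNum a
  | .arr ρ τ, v, f => IsValue v ∧ ∀ (u : Term [] ρ) (a : ρ.tr.El), Rel u a →
      ∃ w : Term [] τ, Eval (.app v u) (ap f a).1 w ∧ Rel w (ap f a).2

/-- The logical relation between closed terms and denotations with costs. -/
def RelC {ρ : Ty} (e : Term [] ρ) (p : ρ.Comp) : Prop :=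
  ∃ v : Term [] ρ, Eval e p.1 v ∧ Rel v p.2

theorem Rel.isValue : ∀ {ρ : Ty} {v : Term [] ρ} {x : ρ.tr.El}, Rel v x → IsValue v
  | .nat, _, n, h => by
    have h' : _ = num n := h
    exact h' ▸ isValue_num n
  | .list, _, a, h => by
    have h' : _ = listNum a := h
    exact h' ▸ isValue_listNum a
  | .arr _ _, _, _, h => h.1

theorem rel_num (n : ℕ) : Rel (ρ := .nat) (num n) n := rfl

theorem rel_listNum (a : List ℕ) : Rel (ρ := .list) (listNum a) a := rfl

theorem Rel.relC {ρ : Ty} {v : Term [] ρ} {x : ρ.tr.El} (h : Rel v x) : RelC v (0, x) :=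
  ⟨v, .val h.isValue, h⟩

theorem Rel.app {ρ τ : Ty} {v : Term [] (.arr ρ τ)} {f : (Ty.arr ρ τ).tr.El} {u : Term [] ρ}
    {a : ρ.tr.El} (hv : Rel v f) (hu : Rel u a) : RelC (.app v u) (ap f a) :=
  hv.2 u a hu

theorem RelC.app {ρ τ : Ty} {e : Term [] (.arr ρ τ)} {e' : Term [] ρ} {p : (Ty.arr ρ τ).Comp}
    {q : ρ.Comp} (h : RelC e p) (h' : RelC e' q) : RelC (.app e e') (circ p q) := by
  obtain ⟨v, hv, hv'⟩ := h
  obtain ⟨u, hu, hu'⟩ := h'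
  obtain ⟨w, hw, hw'⟩ := hv'.app hu'
  exact ⟨w, hv.app' hu hw, hw'⟩

/-- Each rewrite with a defining rule accounts for one `cplus 1` in the model. -/
theorem RelC.rule {Γ : List Ty} {ρ : Ty} {l r : Term Γ ρ} {p : ρ.Comp} (hr : Rule l r)
    (θ : ∀ {τ : Ty}, Var Γ τ → Term [] τ) (hθ : ∀ {τ : Ty} (x : Var Γ τ), IsValue (θ x))
    (h : RelC (r.subst θ) p) : RelC (l.subst θ) (cplus 1 p) := by
  obtain ⟨v, hv, hv'⟩ := h
  refine ⟨v, ?_, hv'⟩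
  rw [cplus, Nat.add_comm]
  exact .rule hr hθ hv

/-- Here `p` is the denotation of the body, before the β-step is charged. The same form serves for
source abstractions and for the `λ` created by the successor rule of `bar₁`. -/
theorem rel_lam {ρ τ : Ty} {r : Term [ρ] τ} {f : (Ty.arr ρ τ).tr.El} (p : ρ.tr.El → τ.Comp)
    (hf : ∀ a, ap f a = cplus 1 (p a))
    (h : ∀ (u : Term [] ρ) (a : ρ.tr.El), Rel u a → RelC (r.inst u) (p a)) :
    Rel (.lam r) f := by
  refine ⟨.lam r, fun u a hu => ?_⟩
  obtain ⟨w, hw, hw'⟩ := h u a hu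
  rw [hf]
  refine ⟨w, ?_, hw'⟩
  rw [cplus, Nat.add_comm]
  exact .beta hu.isValue hw

/-- A value that yields a value when it is applied is related to a function without costs. -/
theorem rel_of_partial {ρ τ : Ty} {t : Term [] (.arr ρ τ)} {f : (Ty.arr ρ τ).tr.El}
    (ht : IsValue t) (h : ∀ (u : Term [] ρ) (a : ρ.tr.El), Rel u a →
      (ap f a).1 = 0 ∧ Rel (.app t u) (ap f a).2) :
    Rel t f := by
  refine ⟨ht, fun u a hu => ?_⟩
  obtain ⟨h0, h1⟩ := h u a hu
  rw [h0]
  exact ⟨_, .val h1.isValue, h1⟩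

/-! ### Substitutions by values -/

theorem isValue_snil {τ : Ty} (x : Var [] τ) : IsValue (snil x) := nomatch x

theorem isValue_scons {Γ : List Ty} {σ : Ty} {u : Term [] σ}
    {θ : ∀ {τ : Ty}, Var Γ τ → Term [] τ} (hu : IsValue u)
    (hθ : ∀ {τ : Ty} (x : Var Γ τ), IsValue (θ x)) {τ : Ty} (x : Var (σ :: Γ) τ) :
    IsValue (scons u θ x) := by
  cases x with
  | zero => exact hu
  | succ x => exact hθ x

/-! ### Function symbols on base types -/

theorem relC_closed_rule {l : Term [] .nat} {n : ℕ} (hr : Rule l (num n)) :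
    RelC l ((1, n) : Ty.nat.Comp) := by
  have h := RelC.rule hr snil isValue_snil (p := ((0, n) : Ty.nat.Comp))
    (by rw [subst_snil]; exact (rel_num n).relC)
  rwa [subst_snil] at h

/-- Relates the sequence passed to the first argument of `bar` to its model. Each query is one
rewrite, whence the cost `1` in `extVal`. -/
theorem rel_ext (a : List ℕ) : Rel (Term.ext (listNum a)) (extVal a) := by
  refine ⟨.fn_app (by simp [missing]) (.fn _) (isValue_listNum a), fun u n hu => ?_⟩
  obtain rfl : u = num n := hu
  exact relC_closed_rule (.ext a n)

/-! ### Fold -/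

theorem relC_fold {ρ : Ty} {x : Term [] ρ} {b : ρ.tr.El} {y : Term [] (.arr .nat (.arr ρ ρ))}
    {h : (Ty.arr .nat (.arr ρ ρ)).tr.El} (hx : Rel x b) (hy : Rel y h) (a : List ℕ) :
    RelC (Term.fold x y (listNum a)) (foldVal b h a) := by
  induction a using List.reverseRecOn with
  | nil =>
    exact RelC.rule (.fold_nil ρ) (scons y (scons x snil))
      (isValue_scons hy.isValue (isValue_scons hx.isValue isValue_snil)) hx.relC
  | append_singleton a n ih =>
    rw [foldVal_snoc, listNum_append]
    exact RelC.rule (.fold_snoc ρ) (scons (num n) (scons (listNum a) (scons y (scons x snil))))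
      (isValue_scons (isValue_num n) (isValue_scons (isValue_listNum a)
        (isValue_scons hy.isValue (isValue_scons hx.isValue isValue_snil))))
      -- The contractum `y n (fold x y a)` is an application of an evaluated `y n` to a recursive
      -- call, which is the shape of `circ`.
      ((hy.app (rel_num n)).app ih)

/-! ### Bar recursion -/

section Bar

variable {f : Term [] tyOmega} {g : Term [] tyG} {h : Term [] tyH}
  {ω : tyOmega.tr.El} {γ : tyG.tr.El} {η : tyH.tr.El}

theorem relC_bar₁_zero (hf : Rel f ω) (hg : Rel g γ) (hh : Rel h η) (a : List ℕ) :
    RelC (Term.bar₁ f g h (listNum a) (num 0)) (bar₁Val ω γ η a 0) :=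
  RelC.rule .bar₁_zero (scons (listNum a) (scons h (scons g (scons f snil))))
    (isValue_scons (isValue_listNum a) (isValue_scons hh.isValue
      (isValue_scons hg.isValue (isValue_scons hf.isValue isValue_snil))))
    (hg.app (rel_listNum a))

/-- The recursive calls are a hypothesis, so that the lemma serves both inside the bar induction and
after it. The predecessor `m` is discarded by the rule. -/
theorem relC_bar₁_succ (hf : Rel f ω) (hg : Rel g γ) (hh : Rel h η) (a : List ℕ)
    (ih : ∀ n, RelC (Term.bar f g h (listNum (a ++ [n]))) (barVal ω γ η (a ++ [n]))) (m : ℕ) :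
    RelC (Term.bar₁ f g h (listNum a) (num (m + 1))) (bar₁Val ω γ η a (m + 1)) := by
  refine RelC.rule .bar₁_succ
    (scons (num m) (scons (listNum a) (scons h (scons g (scons f snil)))))
    (isValue_scons (isValue_num m) (isValue_scons (isValue_listNum a) (isValue_scons hh.isValue
      (isValue_scons hg.isValue (isValue_scons hf.isValue isValue_snil)))))
    -- The `λ` is itself a value of cost `0`; its β-step is the `cplus 1` inside `natFun`.
    (RelC.app (hh.app (rel_listNum a)) (Rel.relC (rel_lam (fun n => barVal ω γ η (a ++ [n]))
      (fun n => rfl) fun u n hu => ?_)))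
  obtain rfl : u = num n := hu
  rw [inst_subst_liftSub]
  have h' := ih n
  rw [listNum_append] at h'
  exact h'

/-- Induction over the unstopped nodes of the model. The constant `4` in `barVal` pays for the rules
of `bar`, `len`, `<` and `bar₁`; evaluating `f (ext a)` contributes the cost component of `omegaAt ω
a`. -/
theorem relC_bar (hf : Rel f ω) (hg : Rel g γ) (hh : Rel h η) (a : List ℕ) :
    RelC (Term.bar f g h (listNum a)) (barVal ω γ η a) := by
  induction a using (barStep_wf ω).induction with
  | _ a ih =>
    obtain ⟨u, hu, hu'⟩ : RelC (.app f (Term.ext (listNum a))) (omegaAt ω a) := hf.app (rel_ext a)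
    obtain rfl : u = num (omegaAt ω a).2 := hu'
    obtain ⟨v, hv, hv'⟩ := relC_closed_rule (.len a)
    obtain rfl : v = num a.length := hv'
    obtain ⟨w, hw, hw'⟩ := relC_closed_rule (.less (omegaAt ω a).2 a.length)
    obtain rfl : w = num (if (omegaAt ω a).2 < a.length then 0 else 1) := hw'
    have hlt := Eval.app' (Eval.app' (.val (.fn .less)) hu
      (.val (.fn_app (by simp [missing]) (.fn .less) (isValue_num _)))) hv hw
    -- With four of its five arguments `bar₁` is a value, so only the comparison remains to be
    -- evaluated.
    have hval : IsValue (.app (.app (.app (.app (.fn .bar₁) f) g) h) (listNum a)) :=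
      .fn_app (by simp [missing]) (.fn_app (by simp [missing]) (.fn_app (by simp [missing]) (.fn_app (by simp [missing]) (.fn _)
        hf.isValue) hg.isValue) hh.isValue) (isValue_listNum a)
    have key : RelC (Term.bar₁ f g h (listNum a)
        (num (if (omegaAt ω a).2 < a.length then 0 else 1)))
        (bar₁Val ω γ η a (if (omegaAt ω a).2 < a.length then 0 else 1)) := by
      by_cases hs : (omegaAt ω a).2 < a.length
      · simp only [if_pos hs]
        exact relC_bar₁_zero hf hg hh a
      · simp only [if_neg hs]
        -- A failed comparison returns the numeral of `1 = 0 + 1`. The failure `hs` is also what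
        -- puts `a * n` below `a` in the induction order.
        exact relC_bar₁_succ hf hg hh a (fun n => ih _ ⟨hs, n, rfl⟩) 0
    obtain ⟨z, hz, hz'⟩ := key
    -- The cost is left to be read off from the assembled evaluation and is compared with
    -- `barVal_eq` afterwards.
    have hbar : RelC (Term.bar f g h (listNum a)) _ :=
      RelC.rule .bar (scons (listNum a) (scons h (scons g (scons f snil))))
        (isValue_scons (isValue_listNum a) (isValue_scons hh.isValue
          (isValue_scons hg.isValue (isValue_scons hf.isValue isValue_snil))))
        (p := (_, _)) ⟨z, Eval.app' (.val hval) hlt hz, hz'⟩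
    convert hbar using 1
    rw [barVal_eq]
    by_cases hs : (omegaAt ω a).2 < a.length
    · simp only [if_pos hs, bar₁Val, cplus]
      congr 1
      omega
    · simp only [if_neg hs, bar₁Val, cplus]
      congr 1
      omega

theorem relC_bar₁ (hf : Rel f ω) (hg : Rel g γ) (hh : Rel h η) (a : List ℕ) (m : ℕ) :
    RelC (Term.bar₁ f g h (listNum a) (num m)) (bar₁Val ω γ η a m) := by
  cases m with
  | zero => exact relC_bar₁_zero hf hg hh a
  | succ m => exact relC_bar₁_succ hf hg hh a (fun n => relC_bar hf hg hh _) m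

end Bar

/-! ### The fundamental lemma -/

/-- A constructor stays a value even with all its arguments, so every application is free. -/
theorem rel_con {δs : List Ty} {δ : Ty} (c : Con δs δ) {Γ : List MTy}
    (ξ : (envSpace Γ).carrier) :
    RelC (.con c) ((c.tr (Γ := Γ)).den.1 ξ) := by
  cases c with
  | zero => exact Rel.relC (rel_num 0)
  | nil => exact Rel.relC (rel_listNum [])
  | succ =>
    refine Rel.relC (rel_of_partial (.con _) fun u n hu => ⟨rfl, ?_⟩)
    obtain rfl : u = num n := hu
    exact rel_num (n + 1)
  | snoc =>
    refine Rel.relC (rel_of_partial (.con _) fun u a hu => ⟨rfl, ?_⟩)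
    refine rel_of_partial (.con_app trivial (.con _) hu.isValue) fun v n hv => ⟨rfl, ?_⟩
    obtain rfl : u = listNum a := hu
    obtain rfl : v = num n := hv
    exact (listNum_append a n).symm

theorem rel_binary {f : Fn [.nat, .nat] .nat} {F : (Ty.arr .nat (.arr .nat .nat)).tr.El}
    (op : ℕ → ℕ → ℕ) (hF : ∀ m, (ap (ρ := .nat) F m).1 = 0)
    (hF' : ∀ m n, ap (ρ := .nat) (ap (ρ := .nat) F m).2 n = (1, op m n))
    (hr : ∀ m n, Rule (Γ := []) (.app (.app (.fn f) (num m)) (num n)) (num (op m n))) :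
    Rel (.fn f) F := by
  refine rel_of_partial (.fn _) fun u m hu => ⟨hF m, .fn_app (by simp [missing]) (.fn _) hu.isValue, ?_⟩
  intro v n hv
  obtain rfl : u = num m := hu
  obtain rfl : v = num n := hv
  rw [hF']
  exact relC_closed_rule (hr m n)

/-- Arguments before the last are absorbed at cost `0` by `rel_of_partial`; the last one triggers
the lemma for the saturated symbol. -/
theorem rel_fn {ρs : List Ty} {ρ : Ty} (f : Fn ρs ρ) {Γ : List MTy}
    (ξ : (envSpace Γ).carrier) :
    RelC (.fn f) ((f.tr (Γ := Γ)).den.1 ξ) := by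
  cases f with
  | fold ρ =>
    refine Rel.relC (rel_of_partial (.fn _) fun x b hx => ⟨rfl, ?_⟩)
    have h₁ := IsValue.fn_app (by simp [missing]) (.fn (.fold ρ)) hx.isValue
    refine rel_of_partial h₁ fun y h hy => ⟨rfl, .fn_app (by simp [missing]) h₁ hy.isValue, ?_⟩
    intro z a hz
    obtain rfl : z = listNum a := hz
    exact relC_fold hx hy a
  | plus => exact (rel_binary (· + ·) (fun _ => rfl) (fun _ _ => rfl) .plus).relC
  | times => exact (rel_binary (· * ·) (fun _ => rfl) (fun _ _ => rfl) .times).relC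
  | less =>
    exact (rel_binary (fun m n => if m < n then 0 else 1) (fun _ => rfl) (fun _ _ => rfl)
      .less).relC
  | len =>
    refine Rel.relC ⟨.fn _, fun u a hu => ?_⟩
    obtain rfl : u = listNum a := hu
    exact relC_closed_rule (.len a)
  | ext =>
    refine Rel.relC (rel_of_partial (.fn _) fun u a hu => ⟨rfl, ?_⟩)
    obtain rfl : u = listNum a := hu
    exact rel_ext a
  | bar =>
    refine Rel.relC (rel_of_partial (.fn _) fun f ω hf => ⟨rfl, ?_⟩)
    have h₁ := IsValue.fn_app (by simp [missing]) (.fn .bar) hf.isValue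
    refine rel_of_partial h₁ fun g γ hg => ⟨rfl, ?_⟩
    have h₂ := IsValue.fn_app (by simp [missing]) h₁ hg.isValue
    refine rel_of_partial h₂ fun h η hh => ⟨rfl, .fn_app (by simp [missing]) h₂ hh.isValue, ?_⟩
    intro z a hz
    obtain rfl : z = listNum a := hz
    exact relC_bar hf hg hh a
  | bar₁ =>
    refine Rel.relC (rel_of_partial (.fn _) fun f ω hf => ⟨rfl, ?_⟩)
    have h₁ := IsValue.fn_app (by simp [missing]) (.fn .bar₁) hf.isValue
    refine rel_of_partial h₁ fun g γ hg => ⟨rfl, ?_⟩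
    have h₂ := IsValue.fn_app (by simp [missing]) h₁ hg.isValue
    refine rel_of_partial h₂ fun h η hh => ⟨rfl, ?_⟩
    have h₃ := IsValue.fn_app (by simp [missing]) h₂ hh.isValue
    refine rel_of_partial h₃ fun z a hz => ⟨rfl, .fn_app (by simp [missing]) h₃ hz.isValue, ?_⟩
    intro w m hw
    obtain rfl : z = listNum a := hz
    obtain rfl : w = num m := hw
    exact relC_bar₁ hf hg hh a m

/-- Every term, with related values substituted for its variables, is related to its denotation. -/
theorem relC_subst {Γ : List Ty} {ρ : Ty} (t : Term Γ ρ)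
    (θ : ∀ {τ : Ty}, Var Γ τ → Term [] τ) (ξ : (envSpace (Γ.map Ty.tr)).carrier)
    (hθ : ∀ {τ : Ty} (x : Var Γ τ), Rel (θ x) (x.tr.den.1 ξ)) :
    RelC (t.subst θ) (t.tr.den.1 ξ) := by
  induction t with
  | var x => exact (hθ x).relC
  | con c => exact rel_con c ξ
  | fn f => exact rel_fn f ξ
  | @lam Γ σ τ t ih =>
    refine Rel.relC (rel_lam (fun a => t.tr.den.1 (a, ξ)) (fun a => ?_) fun u a hu => ?_)
    -- `MTerm.inc` is interpreted as a successor, whereas `cplus` adds the `1` on the left.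
    · exact Prod.ext (Nat.add_comm _ 1) rfl
    · rw [inst_subst_liftSub]
      refine ih (scons u θ) (a, ξ) fun x => ?_
      cases x with
      | zero => exact hu
      | succ x => exact hθ x
  -- The translated application unfolds definitionally to `circ`.
  | app t s ih₁ ih₂ => exact (ih₁ θ ξ hθ).app (ih₂ θ ξ hθ)

theorem relC_denote {ρ : Ty} (e : Term [] ρ) : RelC e (denote e) := by
  have h := relC_subst e snil () fun x => nomatch x
  rwa [subst_snil] at h

end BarCost

theorem mainTheorem5 (ρ : BarCost.Ty) (e : BarCost.Term [] ρ) :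
    ∃ v : BarCost.Term [] ρ, BarCost.IsValue v ∧ BarCost.Eval e (BarCost.denote e).1 v := by
  obtain ⟨v, hv, hv'⟩ := BarCost.relC_denote e
  exact ⟨v, hv'.isValue, hv⟩
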